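/- Consider a single-hop radio network with one channel and collision detection: there are $n$ nodes with unique ids in $\{1,\dots,n\}$, and a non-empty set $S$ of nodes, chosen by an adversary, is active from the start, while all other nodes only listen. Time proceeds in synchronous rounds. In each round every active node either transmits a message or listens; it decides this by an arbitrary rule depending on $n$, its id, its random bits and what it observed in earlier rounds (it has no advance knowledge of $S$, and the joint distribution of the nodes' random bits, independent or not, does not depend on $S$). At the end of a round a listening node observes silence if no node transmits, the message if exactly one node transmits, and a collision if at least two nodes transmit; a transmitting node observes whether or not it transmitted alone. Wake-up is solved in the first round in which exactly one active node transmits (rounds are numbered from $1$). A randomized algorithm (given for every $n$) solves wake-up in $f(n)$ rounds in expectation if, for every $n$ and every non-empty set $S$ of active nodes, the expected number of the round in which wake-up is solved is at most $f(n)$. Theorem. Let $\mathcal A$ be any randomized algorithm, not necessarily uniform, that solves wake-up in $f(n)$ rounds in expectation in single-hop radio networks with a single channel and collision detection, where $f:\mathbb N\to\mathbb R$. Then $f(n)\in\Omega(\log\log n)$, i.e. there are $c>0$ and $n_0$ such that $f(n)\ge c\log\log n$ for all $n\ge n_0$. -/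

import Mathlib

open Filter Asymptotics MeasureTheory
open scoped ENNReal

universe u

/-- What a node learns at the end of a round in a single-hop, single-channel radio network with
collision detection. A listening node learns `silence`, a `message`, or `collision`; a
transmitting node learns whether it broadcast `alone` or there was a `collision`. -/
inductive Feedback (M : Type u) : Type u
  | silence
  | message (m : M)
  | alone
  | collision

/-- The messages transmitted by the nodes other than `i`, where `x j = some m` means that `j`
transmits `m`, and `x j = none` means that `j` listens. In a single-hop network all these nodes
are neighbours of `i`. -/
def messagesOfOthers {n : ℕ} {M : Type u} (x : Fin n → Option M) (i : Fin n) : List M :=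
  ((List.finRange n).filter (fun j => j ≠ i)).filterMap x

/-- The feedback of node `i` in a round in which the nodes behave according to `x`. -/
def feedback {n : ℕ} {M : Type u} (x : Fin n → Option M) (i : Fin n) : Feedback M :=
  match x i, messagesOfOthers x i with
  | none, [] => .silence
  | none, [m] => .message m
  | none, _ :: _ :: _ => .collision
  | some _, [] => .alone
  | some _, _ :: _ => .collision

/-- A randomized algorithm for `n` nodes with unique ids in `Fin n`. All random bits that node `i`
will ever use are collected in one random element of `Coins i`. In each round, a node decides
whether to transmit a message (`some m`) or to listen (`none`) as an arbitrary function of its id,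
its own coins and the feedback it got in the previous rounds (in chronological order).

Private independent coins are the case where `law` is a product measure; arbitrary joint laws
(for instance shared coins) are allowed as well. Neither `law` nor `act` depends on
the set of active nodes. -/
structure RadioAlgorithm (n : ℕ) : Type (u + 1) where
  Msg : Type u
  Coins : Fin n → Type u
  measurableCoins : ∀ i, MeasurableSpace (Coins i)
  law : Measure (∀ i, Coins i)
  isProbabilityMeasure_law : IsProbabilityMeasure law
  act : ∀ i, Coins i → List (Feedback Msg) → Option Msg
  measurableSet_transmit : ∀ i h, MeasurableSet {c | (act i c h).isSome}

attribute [instance] RadioAlgorithm.measurableCoins RadioAlgorithm.isProbabilityMeasure_law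

namespace RadioAlgorithm

variable {n : ℕ} (A : RadioAlgorithm.{u} n) (S : Finset (Fin n)) (ω : ∀ i, A.Coins i)

/-- The behaviour of all nodes in a round, when `S` is the set of active nodes, the coins are `ω`
and `h i` is the feedback that node `i` got so far. Inactive nodes only listen. -/
def choices (h : Fin n → List (Feedback A.Msg)) (i : Fin n) : Option A.Msg :=
  if i ∈ S then A.act i (ω i) (h i) else none

/-- The feedback that each node got during the first `r` rounds. -/
def history : ℕ → Fin n → List (Feedback A.Msg)
  | 0 => fun _ => []
  | r + 1 => fun i => history r i ++ [feedback (A.choices S ω (history r)) i]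

/-- Node `i` transmits in round `r + 1`. -/
def Transmits (r : ℕ) (i : Fin n) : Prop :=
  (A.choices S ω (A.history S ω r) i).isSome

/-- The number of the first round (rounds are numbered from `1`) in which exactly one node
transmits; `⊤` if there is no such round. Only active nodes ever transmit. -/
noncomputable def wakeUpTime : ℕ∞ :=
  ⨅ (r : ℕ) (_ : ∃! i, A.Transmits S ω r i), ((r + 1 : ℕ) : ℕ∞)

/-- The expected number of rounds until wake-up is solved when the set of active nodes is `S`. -/
noncomputable def expectedWakeUpTime : ℝ≥0∞ :=
  ∫⁻ ω, (A.wakeUpTime S ω : ℝ≥0∞) ∂A.law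

end RadioAlgorithm

/-- The algorithm `A`, given for every network size `n`, solves wake-up in `f n` rounds in
expectation, whichever non-empty set of nodes is activated. -/
def SolvesWakeUpInExpectation (A : (n : ℕ) → RadioAlgorithm.{u} n) (f : ℕ → ℝ) : Prop :=
  ∀ (n : ℕ) (S : Finset (Fin n)), S.Nonempty →
    (A n).expectedWakeUpTime S ≤ ENNReal.ofReal (f n)

/-! Until wake-up, every round is silent or a collision, and all nodes get the same feedback
(`exists_feedback_eq`). So the history before wake-up is a common bit string, and fewer than `2 ^ r`
strings are shorter than `r`. Given the string and the coins, the set `T` of nodes willing to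
transmit no longer depends on `S`; the round succeeds iff `|S ∩ T| = 1`. Draw `S` with density `2 ^
(-k)` and sum over `k = 1, …, L`, where `2 ^ L ≤ n`. For every `T` the success probabilities add up
to at most 2 (`sum_isolation_probability_le`), while the non-empty sets carry weight at least `L /
2`. A union bound over the strings yields, once `8 * 2 ^ r < L`, a non-empty `S` that survives `r`
rounds with probability at least `1 / 2`, so its expected time is at least `r / 2`. Taking `L ≈ log
n` allows `r ≈ log log n`. -/

/-! ### Random sets of a given density -/

/-- The probability that a random subset of `ι` that contains every element independently with
probability `p` equals `S`. -/
def bernoulliWeight {ι : Type*} [Fintype ι] [DecidableEq ι] (p : ℝ) (S : Finset ι) : ℝ :=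
  (∏ _i ∈ S, p) * ∏ _i ∈ Finset.univ \ S, (1 - p)

section BernoulliWeight

variable {ι : Type*} [Fintype ι] [DecidableEq ι] {p : ℝ}

theorem bernoulliWeight_nonneg (hp0 : 0 ≤ p) (hp1 : p ≤ 1) (S : Finset ι) :
    0 ≤ bernoulliWeight p S :=
  mul_nonneg (Finset.prod_nonneg fun _ _ => hp0)
    (Finset.prod_nonneg fun _ _ => sub_nonneg.2 hp1)

theorem sum_bernoulliWeight : ∑ S : Finset ι, bernoulliWeight p S = 1 := by
  have h := Finset.prod_add (fun _ : ι => p) (fun _ => 1 - p) Finset.univ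
  rw [Finset.powerset_univ] at h
  simpa [bernoulliWeight] using h.symm

/-- The probability that the random set meets `T` exactly in the element `i ∈ T`. -/
theorem sum_bernoulliWeight_inter_eq_singleton (T : Finset ι) {i : ι} (hi : i ∈ T) :
    ∑ S : Finset ι, (if S ∩ T = {i} then bernoulliWeight p S else 0) =
      p * (1 - p) ^ (T.card - 1) := by
  -- The zeros kill exactly the terms of the expansion whose `S` contains a point of `T` other than
  -- `i` or misses `i`.
  have h := Finset.prod_add (fun j : ι => if j ∈ T.erase i then 0 else p)
    (fun j => if j = i then 0 else 1 - p) Finset.univ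
  rw [Finset.powerset_univ] at h
  have hL : ∏ j : ι, ((if j ∈ T.erase i then 0 else p) + (if j = i then 0 else 1 - p)) =
      p * (1 - p) ^ (T.card - 1) := by
    have : ∀ j : ι, ((if j ∈ T.erase i then 0 else p) + (if j = i then 0 else 1 - p)) =
        (if j = i then p else 1) * (if j ∈ T.erase i then 1 - p else 1) := by
      intro j
      by_cases hj : j = i
      · subst hj; simp
      · by_cases hT : j ∈ T <;> simp [hj, hT]
    simp only [this, Finset.prod_mul_distrib, Finset.prod_ite_eq', Finset.mem_univ, if_true,
      Finset.prod_ite_mem, Finset.univ_inter, Finset.prod_const, Finset.card_erase_of_mem hi]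
  rw [← hL, h]
  refine Finset.sum_congr rfl fun S _ => ?_
  split_ifs with hS
  · have hmem : ∀ j, j ∈ S ∧ j ∈ T ↔ j = i := fun j => by
      rw [← Finset.mem_inter, hS, Finset.mem_singleton]
    unfold bernoulliWeight
    congr 1
    · refine Finset.prod_congr rfl fun j hj => ?_
      rw [if_neg]
      intro hjT
      exact (Finset.mem_erase.1 hjT).1 ((hmem j).1 ⟨hj, (Finset.mem_erase.1 hjT).2⟩)
    · refine Finset.prod_congr rfl fun j hj => ?_
      rw [if_neg]
      rintro rfl
      exact (Finset.mem_sdiff.1 hj).2 ((hmem j).2 rfl).1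
  · symm
    by_cases hiS : i ∈ S
    · obtain ⟨j, hjS, hjT⟩ : ∃ j ∈ S, j ∈ T.erase i := by
        by_contra! hcon
        refine hS (Finset.ext fun j => ?_)
        rw [Finset.mem_inter, Finset.mem_singleton]
        constructor
        · rintro ⟨hjS, hjT⟩
          by_contra hji
          exact hcon j hjS (Finset.mem_erase.2 ⟨hji, hjT⟩)
        · rintro rfl
          exact ⟨hiS, hi⟩
      rw [Finset.prod_eq_zero hjS (by rw [if_pos hjT]), zero_mul]
    · rw [Finset.prod_eq_zero (i := i) (s := Finset.univ \ S) (by simp [hiS]) (by simp), mul_zero]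

/-- The probability that the random set has exactly one element in `T`. -/
theorem sum_bernoulliWeight_existsUnique (T : Finset ι) :
    ∑ S : Finset ι, (if (S ∩ T).card = 1 then bernoulliWeight p S else 0) =
      T.card * (p * (1 - p) ^ (T.card - 1)) := by
  have : ∀ S : Finset ι, (if (S ∩ T).card = 1 then bernoulliWeight p S else 0) =
      ∑ i ∈ T, if S ∩ T = {i} then bernoulliWeight p S else 0 := by
    intro S
    split_ifs with h
    · obtain ⟨i, hi⟩ := Finset.card_eq_one.1 h
      have hiT : i ∈ T := Finset.mem_of_mem_inter_right (hi ▸ Finset.mem_singleton_self i)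
      simp [hi, hiT]
    · refine (Finset.sum_eq_zero fun i _ => if_neg fun hi => h ?_).symm
      rw [hi, Finset.card_singleton]
  simp only [this]
  rw [Finset.sum_comm, Finset.sum_congr rfl fun i hi =>
    sum_bernoulliWeight_inter_eq_singleton T hi, Finset.sum_const, nsmul_eq_mul]

/-- A random set of density `p ≥ 1 / |ι|` is non-empty with probability at least `1 / 2`. -/
theorem half_le_sum_bernoulliWeight_nonempty (hp0 : 0 ≤ p) (hp1 : p ≤ 1)
    (hp : 1 ≤ Fintype.card ι * p) :
    1 / 2 ≤ ∑ S : Finset ι with S.Nonempty, bernoulliWeight p S := by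
  have hsplit := Finset.sum_filter_add_sum_filter_not (Finset.univ : Finset (Finset ι))
    (fun S => S.Nonempty) (bernoulliWeight p)
  have hempty : (Finset.univ.filter fun S : Finset ι => ¬ S.Nonempty) = {∅} := by
    ext S; simp
  rw [sum_bernoulliWeight, hempty, Finset.sum_singleton] at hsplit
  have hw : bernoulliWeight p (∅ : Finset ι) = (1 - p) ^ Fintype.card ι := by
    simp [bernoulliWeight]
  have hq : 0 ≤ (1 - p) ^ Fintype.card ι := pow_nonneg (sub_nonneg.2 hp1) _
  -- Bernoulli's inequality; with `(1 - p) * (1 + p) ≤ 1` it gives `(1 - p) ^ |ι| ≤ 1 / 2`.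
  have hb : 2 ≤ (1 + p) ^ Fintype.card ι := by
    have := one_add_mul_le_pow (show -2 ≤ p by linarith) (Fintype.card ι)
    linarith
  have hm : (1 - p) ^ Fintype.card ι * (1 + p) ^ Fintype.card ι ≤ 1 := by
    rw [← mul_pow]
    exact pow_le_one₀ (mul_nonneg (by linarith) (by linarith)) (by nlinarith)
  nlinarith

end BernoulliWeight

/-! ### Averaging over the densities `1 / 2 ^ k` -/

/-- Mean value bound: the derivative of `x ^ t` on `[b, a]` is smallest at `b`. -/
theorem mul_sub_mul_pow_le_pow_sub_pow {a b : ℝ} (hb : 0 ≤ b) (hab : b ≤ a) (t : ℕ) :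
    t * ((a - b) * b ^ (t - 1)) ≤ a ^ t - b ^ t := by
  induction t with
  | zero => simp
  | succ t ih =>
    have hpow : b ^ t ≤ a ^ t := pow_le_pow_left₀ hb hab t
    have hbt : (t : ℝ) * b ^ t = t * (b ^ (t - 1) * b) := by
      cases t <;> simp [pow_succ]
    have h1 := mul_le_mul_of_nonneg_right ih hb
    have h2 := mul_le_mul_of_nonneg_right hpow (sub_nonneg.2 hab)
    have h3 : (a - b) * (t * b ^ t) = (a - b) * (t * (b ^ (t - 1) * b)) := by rw [hbt]
    have h4 : 0 ≤ (a ^ t - b ^ t) * (a - b) :=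
      mul_nonneg (sub_nonneg.2 hpow) (sub_nonneg.2 hab)
    push_cast
    rw [pow_succ, pow_succ]
    nlinarith

/-- Halving the density `p` raises `(1 - p) ^ t` by at least half the summand, so the sum telescopes
to a bound uniform in `t` and `L`. -/
theorem sum_isolation_probability_le (t L : ℕ) :
    ∑ k ∈ Finset.range L,
      (t : ℝ) * ((1 / 2) ^ (k + 1) * (1 - (1 / 2) ^ (k + 1)) ^ (t - 1)) ≤ 2 := by
  have hx : ∀ k : ℕ, (0 : ℝ) ≤ (1 / 2) ^ k ∧ ((1 : ℝ) / 2) ^ k ≤ 1 := fun k =>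
    ⟨by positivity, pow_le_one₀ (by norm_num) (by norm_num)⟩
  have hstep : ∀ k ∈ Finset.range L,
      (t : ℝ) * ((1 / 2) ^ (k + 1) * (1 - (1 / 2) ^ (k + 1)) ^ (t - 1)) ≤
        2 * (1 - (1 / 2) ^ (k + 2)) ^ t - 2 * (1 - (1 / 2) ^ (k + 1)) ^ t := by
    intro k _
    have h2 : ((1 : ℝ) / 2) ^ (k + 2) = (1 / 2) ^ (k + 1) / 2 := by ring
    have h := mul_sub_mul_pow_le_pow_sub_pow (a := 1 - (1 / 2) ^ (k + 2))
      (b := 1 - (1 / 2) ^ (k + 1)) (sub_nonneg.2 (hx _).2)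
      (by rw [h2]; linarith [(hx (k + 1)).1]) t
    have h3 : (1 - (1 / 2 : ℝ) ^ (k + 2)) - (1 - (1 / 2) ^ (k + 1)) = (1 / 2) ^ (k + 1) / 2 := by
      rw [h2]; ring
    rw [h3] at h
    linarith
  refine (Finset.sum_le_sum hstep).trans ?_
  rw [Finset.sum_range_sub (fun k => 2 * (1 - (1 / 2 : ℝ) ^ (k + 1)) ^ t)]
  have h1 : (1 - (1 / 2 : ℝ) ^ (L + 1)) ^ t ≤ 1 :=
    pow_le_one₀ (sub_nonneg.2 (hx _).2) (by linarith [(hx (L + 1)).1])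
  have h0 : 0 ≤ (1 - (1 / 2 : ℝ) ^ (0 + 1)) ^ t := pow_nonneg (by norm_num) _
  linarith

/-- The unnormalised law of a random set whose density is chosen among `1/2, 1/4, …, 1/2 ^ L`. -/
noncomputable def mixedWeight {ι : Type*} [Fintype ι] [DecidableEq ι] (L : ℕ) (S : Finset ι) : ℝ :=
  ∑ k ∈ Finset.range L, bernoulliWeight ((1 / 2) ^ (k + 1)) S

section MixedWeight

variable {ι : Type*} [Fintype ι] [DecidableEq ι]

theorem mixedWeight_nonneg (L : ℕ) (S : Finset ι) : 0 ≤ mixedWeight L S :=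
  Finset.sum_nonneg fun _ _ => bernoulliWeight_nonneg (by positivity)
    (pow_le_one₀ (by norm_num) (by norm_num)) S

theorem sum_mixedWeight_existsUnique_le (L : ℕ) (T : Finset ι) :
    ∑ S : Finset ι, (if (S ∩ T).card = 1 then mixedWeight L S else 0) ≤ 2 := by
  refine le_trans (le_of_eq ?_) (sum_isolation_probability_le T.card L)
  rw [Finset.sum_congr rfl fun k _ => (sum_bernoulliWeight_existsUnique T).symm, Finset.sum_comm]
  refine Finset.sum_congr rfl fun S _ => ?_
  split_ifs <;> simp [mixedWeight]

/-- All `L` densities are at least `1 / |ι|`, so each contributes at least `1 / 2`. -/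
theorem half_le_sum_mixedWeight_nonempty {L : ℕ} (hL : 2 ^ L ≤ Fintype.card ι) :
    (L : ℝ) / 2 ≤ ∑ S : Finset ι with S.Nonempty, mixedWeight L S := by
  unfold mixedWeight
  rw [Finset.sum_comm]
  have h : ∀ k ∈ Finset.range L, (1 : ℝ) / 2 ≤
      ∑ S : Finset ι with S.Nonempty, bernoulliWeight ((1 / 2) ^ (k + 1)) S := by
    intro k hk
    refine half_le_sum_bernoulliWeight_nonempty (by positivity)
      (pow_le_one₀ (by norm_num) (by norm_num)) ?_
    have hk' : 2 ^ (k + 1) ≤ Fintype.card ι :=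
      (Nat.pow_le_pow_right (by norm_num) (Finset.mem_range.1 hk)).trans hL
    have hk'' : (2 : ℝ) ^ (k + 1) ≤ Fintype.card ι := by exact_mod_cast hk'
    rw [one_div, inv_pow, ← div_eq_mul_inv]
    exact (one_le_div (by positivity)).2 hk''
  refine le_trans (le_of_eq ?_) (Finset.sum_le_sum h)
  simp [div_eq_mul_inv]

end MixedWeight

/-- If `∑ i, w i * 1_{B i} ≤ C` pointwise, then the same holds for the probabilities. -/
theorem sum_mul_measureReal_le {Ω ι : Type*} [MeasurableSpace Ω] (μ : Measure Ω)
    [IsProbabilityMeasure μ] (s : Finset ι) (w : ι → ℝ) (B : ι → Set Ω)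
    (hB : ∀ i, MeasurableSet (B i)) {C : ℝ}
    (h : ∀ ω, ∑ i ∈ s, (B i).indicator (fun _ => w i) ω ≤ C) :
    ∑ i ∈ s, w i * μ.real (B i) ≤ C := by
  have hint : ∀ i ∈ s, Integrable ((B i).indicator fun _ => w i) μ := fun i _ =>
    (integrable_const _).indicator (hB i)
  calc ∑ i ∈ s, w i * μ.real (B i)
      = ∑ i ∈ s, ∫ ω, (B i).indicator (fun _ => w i) ω ∂μ := by
        refine Finset.sum_congr rfl fun i _ => ?_
        rw [integral_indicator_const _ (hB i), smul_eq_mul, mul_comm]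
    _ = ∫ ω, ∑ i ∈ s, (B i).indicator (fun _ => w i) ω ∂μ := (integral_finsetSum s hint).symm
    _ ≤ ∫ _, C ∂μ := integral_mono (integrable_finsetSum s hint) (integrable_const C) h
    _ = C := by simp

/-! ### Histories before wake-up -/

theorem length_messagesOfOthers {n : ℕ} {M : Type u} (x : Fin n → Option M) (i : Fin n) :
    (messagesOfOthers x i).length =
      (Finset.univ.filter fun j => j ≠ i ∧ (x j).isSome).card := by
  rw [messagesOfOthers, List.length_filterMap_eq_countP, List.countP_filter,
    ← List.toFinset_finRange, (List.nodup_finRange n).card_eq_countP]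
  congr 1
  funext j
  simp [Bool.and_comm]

/-- The feedback of an unsuccessful round: `false` is silence and `true` is a collision. -/
def commonFeedback (M : Type u) (b : Bool) : Feedback M :=
  if b then .collision else .silence

/-- In an unsuccessful round, all nodes get the same feedback. -/
theorem exists_feedback_eq {n : ℕ} {M : Type u} (x : Fin n → Option M)
    (hx : ¬ ∃! i, (x i).isSome) : ∃ b, ∀ i, feedback x i = commonFeedback M b := by
  by_cases h : ∃ j, (x j).isSome
  · obtain ⟨j, hj⟩ := h
    -- With two transmitters, a listener has at least two transmitting neighbours and a transmitter
    -- at least one: a collision for both.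
    obtain ⟨k, hk, hkj⟩ : ∃ k, (x k).isSome ∧ k ≠ j := by
      by_contra! hcon
      exact hx ⟨j, hj, hcon⟩
    refine ⟨true, fun i => ?_⟩
    have hlen := length_messagesOfOthers x i
    cases hi : x i with
    | none =>
      have hji : j ≠ i := by rintro rfl; simp [hi] at hj
      have hki : k ≠ i := by rintro rfl; simp [hi] at hk
      have h2 : 1 < (messagesOfOthers x i).length := by
        rw [hlen, Finset.one_lt_card]
        exact ⟨j, by simp [hji, hj], k, by simp [hki, hk], hkj.symm⟩
      match hm : messagesOfOthers x i, h2 with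
      | _ :: _ :: _, _ => simp [feedback, hi, hm, commonFeedback]
    | some m =>
      have h1 : 0 < (messagesOfOthers x i).length := by
        rw [hlen, Finset.card_pos]
        by_cases hji : j = i
        · exact ⟨k, by simp [hji ▸ hkj, hk]⟩
        · exact ⟨j, by simp [hji, hj]⟩
      match hm : messagesOfOthers x i, h1 with
      | _ :: _, _ => simp [feedback, hi, hm, commonFeedback]
  · have hnone : ∀ j, x j = none := fun j => by
      by_contra hj
      exact h ⟨j, Option.isSome_iff_ne_none.2 hj⟩
    refine ⟨false, fun i => ?_⟩
    have hlen := length_messagesOfOthers x i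
    simp only [hnone, Option.isSome_none, Bool.false_eq_true, and_false, Finset.filter_false,
      Finset.card_empty, List.length_eq_zero_iff] at hlen
    simp [feedback, hnone i, hlen, commonFeedback]

/-! ### Union bound over common histories -/

namespace RadioAlgorithm

variable {n : ℕ} (A : RadioAlgorithm.{u} n)

/-- The event that exactly one node of `S` transmits after the history `v`, common to all nodes. -/
def isolationEvent (S : Finset (Fin n)) (v : List Bool) : Set (∀ i, A.Coins i) :=
  {ω | ∃! i, i ∈ S ∧ (A.act i (ω i) (v.map (commonFeedback A.Msg))).isSome}

theorem measurableSet_isolationEvent (S : Finset (Fin n)) (v : List Bool) :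
    MeasurableSet (A.isolationEvent S v) := by
  have h : ∀ i, MeasurableSet {ω : ∀ i, A.Coins i |
      i ∈ S ∧ (A.act i (ω i) (v.map (commonFeedback A.Msg))).isSome} := fun i =>
    (MeasurableSet.const _).inter (measurable_pi_apply i (A.measurableSet_transmit i _))
  have heq : A.isolationEvent S v = ⋃ i, {ω | i ∈ S ∧ (A.act i (ω i)
      (v.map (commonFeedback A.Msg))).isSome} ∩ ⋂ j, ({ω | j ∈ S ∧ (A.act j (ω j)
      (v.map (commonFeedback A.Msg))).isSome}ᶜ ∪ {_ω | j = i}) := by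
    ext ω
    simp only [isolationEvent, ExistsUnique, Set.mem_iUnion, Set.mem_inter_iff, Set.mem_iInter,
      Set.mem_union, Set.mem_compl_iff, Set.mem_ofPred_eq, imp_iff_not_or]
  rw [heq]
  exact MeasurableSet.iUnion fun i => (h i).inter
    (MeasurableSet.iInter fun j => (h j).compl.union (MeasurableSet.const _))

/-- The weight of the sets `S` for which exactly one node of `S` transmits after the history `v`. -/
theorem sum_indicator_isolationEvent_le (L : ℕ) (v : List Bool) (ω : ∀ i, A.Coins i) :
    ∑ S : Finset (Fin n) with S.Nonempty,
      (A.isolationEvent S v).indicator (fun _ => mixedWeight L S) ω ≤ 2 := by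
  refine le_trans ?_ (sum_mixedWeight_existsUnique_le L
    (Finset.univ.filter fun i => (A.act i (ω i) (v.map (commonFeedback A.Msg))).isSome))
  refine (Finset.sum_le_sum_of_subset_of_nonneg (Finset.filter_subset _ _) fun S _ _ =>
    Set.indicator_nonneg (fun _ _ => mixedWeight_nonneg L S) ω).trans (le_of_eq ?_)
  refine Finset.sum_congr rfl fun S _ => ?_
  classical
  rw [Set.indicator_apply]
  refine if_congr ?_ rfl rfl
  rw [Finset.card_eq_one, isolationEvent, Set.mem_ofPred_eq, Finset.singleton_iff_unique_mem]
  simp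

theorem transmits_iff (S : Finset (Fin n)) (ω : ∀ i, A.Coins i) (r : ℕ) (i : Fin n) :
    A.Transmits S ω r i ↔ i ∈ S ∧ (A.act i (ω i) (A.history S ω r i)).isSome := by
  by_cases hi : i ∈ S <;> simp [Transmits, choices, hi]

/-- As long as wake-up is not solved, all nodes have the same history. -/
theorem exists_history_eq (S : Finset (Fin n)) (ω : ∀ i, A.Coins i) (r : ℕ)
    (h : ∀ q < r, ¬ ∃! i, A.Transmits S ω q i) :
    ∃ v : List.Vector Bool r, ∀ i, A.history S ω r i = v.toList.map (commonFeedback A.Msg) := by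
  induction r with
  | zero => exact ⟨List.Vector.nil, fun i => rfl⟩
  | succ r ih =>
    obtain ⟨v, hv⟩ := ih fun q hq => h q (hq.trans r.lt_succ_self)
    obtain ⟨b, hb⟩ := exists_feedback_eq _ (h r r.lt_succ_self)
    let w : List.Vector Bool (r + 1) := ⟨v.toList ++ [b], by simp⟩
    have hw : w.toList = v.toList ++ [b] := rfl
    refine ⟨w, fun i => ?_⟩
    change A.history S ω r i ++ [feedback (A.choices S ω (A.history S ω r)) i] = _
    rw [hb, hv, hw, List.map_append, List.map_singleton]

/-- The event that some common history of fewer than `r` rounds isolates a node of `S`. -/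
def isolationWithin (S : Finset (Fin n)) (r : ℕ) : Set (∀ i, A.Coins i) :=
  ⋃ q : Σ ℓ : Fin r, List.Vector Bool ℓ, A.isolationEvent S q.2.toList

theorem measurableSet_isolationWithin (S : Finset (Fin n)) (r : ℕ) :
    MeasurableSet (A.isolationWithin S r) :=
  MeasurableSet.iUnion fun _ => A.measurableSet_isolationEvent S _

/-- At the first successful round the history is still common, so an early success lies in one of
the isolation events. -/
theorem le_wakeUpTime_of_notMem (S : Finset (Fin n)) {r : ℕ} {ω : ∀ i, A.Coins i}
    (hω : ω ∉ A.isolationWithin S r) : (r : ℕ∞) ≤ A.wakeUpTime S ω := by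
  refine le_iInf₂ fun q hq => ?_
  rw [Nat.cast_le]
  by_contra! hqr
  classical
  obtain ⟨m, hmq, hm, hmin⟩ : ∃ m ≤ q, (∃! i, A.Transmits S ω m i) ∧
      ∀ k < m, ¬ ∃! i, A.Transmits S ω k i :=
    have hex : ∃ q, ∃! i, A.Transmits S ω q i := ⟨q, hq⟩
    ⟨Nat.find hex, Nat.find_min' hex hq, Nat.find_spec hex, fun _ => Nat.find_min hex⟩
  obtain ⟨v, hv⟩ := A.exists_history_eq S ω m hmin
  refine hω (Set.mem_iUnion.2 ⟨⟨⟨m, by omega⟩, v⟩, ?_⟩)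
  simp only [transmits_iff, hv] at hm
  exact hm

theorem card_histories_le (r : ℕ) :
    Fintype.card (Σ ℓ : Fin r, List.Vector Bool ℓ) ≤ 2 ^ r := by
  rw [Fintype.card_sigma]
  simp only [card_vector, Fintype.card_bool]
  rw [Fin.sum_univ_eq_sum_range (fun ℓ => 2 ^ ℓ) r]
  exact (Nat.geomSum_lt le_rfl (by simp)).le

/-- Some non-empty set of active nodes is not woken up in `r` rounds with probability `1 / 2`. -/
theorem exists_measureReal_isolationWithin_le {L r : ℕ} (hL : 2 ^ L ≤ n)
    (hr : 8 * 2 ^ r < L) :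
    ∃ S : Finset (Fin n), S.Nonempty ∧ A.law.real (A.isolationWithin S r) ≤ 1 / 2 := by
  -- Otherwise the weighted failure of the claim would total at least `L / 4`, against the union
  -- bound `2 * 2 ^ r`; this is where the 8 comes from.
  by_contra! hcon
  have hlow := half_le_sum_mixedWeight_nonempty (ι := Fin n) (L := L) (by simpa using hL)
  have hup : ∑ S : Finset (Fin n) with S.Nonempty,
      mixedWeight L S * A.law.real (A.isolationWithin S r) ≤ 2 ^ r * 2 := by
    calc _ ≤ ∑ S : Finset (Fin n) with S.Nonempty, mixedWeight L S *
          ∑ q : Σ ℓ : Fin r, List.Vector Bool ℓ, A.law.real (A.isolationEvent S q.2.toList) :=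
          Finset.sum_le_sum fun S _ => mul_le_mul_of_nonneg_left
            (measureReal_iUnion_fintype_le _) (mixedWeight_nonneg L S)
      _ = ∑ q : Σ ℓ : Fin r, List.Vector Bool ℓ, ∑ S : Finset (Fin n) with S.Nonempty,
          mixedWeight L S * A.law.real (A.isolationEvent S q.2.toList) := by
          simp only [Finset.mul_sum]
          exact Finset.sum_comm
      _ ≤ ∑ _q : Σ ℓ : Fin r, List.Vector Bool ℓ, (2 : ℝ) :=
          Finset.sum_le_sum fun q _ => sum_mul_measureReal_le A.law _ _ _
            (fun S => A.measurableSet_isolationEvent S _)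
            (A.sum_indicator_isolationEvent_le L q.2.toList)
      _ = Fintype.card (Σ ℓ : Fin r, List.Vector Bool ℓ) * (2 : ℝ) := by
          rw [Finset.sum_const, nsmul_eq_mul, Finset.card_univ]
      _ ≤ 2 ^ r * 2 := by
          gcongr
          exact_mod_cast card_histories_le r
  have hmid : (∑ S : Finset (Fin n) with S.Nonempty, mixedWeight L S) * (1 / 2) ≤
      ∑ S : Finset (Fin n) with S.Nonempty,
        mixedWeight L S * A.law.real (A.isolationWithin S r) := by
    rw [Finset.sum_mul]
    exact Finset.sum_le_sum fun S hS => mul_le_mul_of_nonneg_left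
      (hcon S (Finset.mem_filter.1 hS).2).le (mixedWeight_nonneg L S)
  have hr' : (8 : ℝ) * 2 ^ r < L := by exact_mod_cast hr
  linarith

/-- Markov's inequality: the time is at least `r` off the isolation event. -/
theorem ofReal_half_le_expectedWakeUpTime (S : Finset (Fin n)) {r : ℕ}
    (h : A.law.real (A.isolationWithin S r) ≤ 1 / 2) :
    ENNReal.ofReal (r / 2) ≤ A.expectedWakeUpTime S := by
  have hm := A.measurableSet_isolationWithin S r
  have hc : 1 / 2 ≤ A.law.real (A.isolationWithin S r)ᶜ := by
    rw [probReal_compl_eq_one_sub hm]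
    linarith
  calc ENNReal.ofReal (r / 2)
      ≤ ENNReal.ofReal (r * A.law.real (A.isolationWithin S r)ᶜ) := by
        refine ENNReal.ofReal_le_ofReal ?_
        rw [div_eq_mul_one_div]
        exact mul_le_mul_of_nonneg_left hc (Nat.cast_nonneg r)
    _ = r * A.law (A.isolationWithin S r)ᶜ := by
        rw [ENNReal.ofReal_mul (Nat.cast_nonneg r), ENNReal.ofReal_natCast,
          ofReal_measureReal]
    _ = ∫⁻ ω, (A.isolationWithin S r)ᶜ.indicator (fun _ => (r : ℝ≥0∞)) ω ∂A.law :=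
        (lintegral_indicator_const hm.compl _).symm
    _ ≤ A.expectedWakeUpTime S := by
        refine lintegral_mono fun ω => ?_
        by_cases hω : ω ∈ A.isolationWithin S r
        · simp [hω]
        · have hle := ENat.toENNReal_le.2 (A.le_wakeUpTime_of_notMem S hω)
          simpa [hω] using hle

end RadioAlgorithm

/-! ### From the finite bound to asymptotics -/

theorem SolvesWakeUpInExpectation.half_le {A : (n : ℕ) → RadioAlgorithm.{u} n} {f : ℕ → ℝ}
    (hA : SolvesWakeUpInExpectation A f) {n L r : ℕ} (hr0 : 0 < r) (hL : 2 ^ L ≤ n)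
    (hr : 8 * 2 ^ r < L) : (r : ℝ) / 2 ≤ f n := by
  obtain ⟨S, hS, hSr⟩ := (A n).exists_measureReal_isolationWithin_le hL hr
  have h := ((A n).ofReal_half_le_expectedWakeUpTime S hSr).trans (hA n S hS)
  -- `ENNReal.ofReal` truncates negative values, so positivity is needed to return to the reals.
  have hpos : (0 : ℝ) < r / 2 := by positivity
  by_contra! hlt
  exact absurd h (not_le.2 ((ENNReal.ofReal_lt_ofReal_iff hpos).2 hlt))

theorem log_natCast_le_natLog_add_one {m : ℕ} (hm : m ≠ 0) :
    Real.log m ≤ (Nat.log 2 m + 1 : ℕ) * Real.log 2 := by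
  rw [← Real.log_pow]
  refine Real.log_le_log (by positivity) ?_
  exact_mod_cast (Nat.lt_pow_succ_log_self one_lt_two m).le

theorem log_log_natCast_le {n : ℕ} (hn : 4 ≤ n) :
    Real.log (Real.log n) ≤ Nat.log 2 (Nat.log 2 n) + 2 := by
  have hn0 : n ≠ 0 := by omega
  have hlog2 : Real.log 2 ≤ 1 := Real.log_two_lt_d9.le.trans (by norm_num)
  have hlog2' : 0 < Real.log 2 := Real.log_pos one_lt_two
  have hL1 : Nat.log 2 n ≠ 0 := (Nat.log_pos one_lt_two (by omega)).ne'
  have h1 : Real.log n ≤ 2 * (Nat.log 2 n : ℝ) := by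
    have h := log_natCast_le_natLog_add_one hn0
    have h' : (1 : ℝ) ≤ Nat.log 2 n := by exact_mod_cast Nat.one_le_iff_ne_zero.2 hL1
    push_cast at h
    nlinarith
  have h0 : 0 < Real.log n := Real.log_pos (by exact_mod_cast (by omega : 1 < n))
  have h2 := Real.log_le_log h0 h1
  rw [Real.log_mul two_ne_zero (by exact_mod_cast hL1)] at h2
  have h3 := log_natCast_le_natLog_add_one hL1
  push_cast at h3
  have h4 : (0 : ℝ) ≤ Nat.log 2 (Nat.log 2 n) := Nat.cast_nonneg _
  nlinarith

theorem mainTheorem6 (A : (n : ℕ) → RadioAlgorithm.{u} n) (f : ℕ → ℝ)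
    (hA : SolvesWakeUpInExpectation A f) :
    (fun n : ℕ => Real.log (Real.log (n : ℝ))) =O[atTop] f := by
  have htend : Tendsto (fun n : ℕ => Real.log (Real.log (n : ℝ))) atTop atTop :=
    Real.tendsto_log_atTop.comp (Real.tendsto_log_atTop.comp tendsto_natCast_atTop_atTop)
  -- For `r = log₂ L - 4`: `log log n ≤ r + 6 ≤ 2 * r ≤ 4 * f n`; the threshold 12 ensures `r ≥ 6`.
  refine IsBigO.of_bound 4 ?_
  filter_upwards [htend.eventually_ge_atTop 12, eventually_ge_atTop 4] with n hn12 hn4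
  have hle := log_log_natCast_le hn4
  set L := Nat.log 2 n with hLdef
  have hm : 10 ≤ Nat.log 2 L := by
    have : (10 : ℝ) ≤ Nat.log 2 L := by linarith
    exact_mod_cast this
  -- The shift by 4 gives `16 * 2 ^ r ≤ L`, hence the strict `8 * 2 ^ r < L`.
  obtain ⟨r, hr⟩ : ∃ r, Nat.log 2 L = r + 4 := ⟨Nat.log 2 L - 4, by omega⟩
  have hL0 : L ≠ 0 := by
    intro h
    simp [h] at hm
  have hpow : 2 ^ (r + 4) ≤ L := hr ▸ Nat.pow_log_le_self 2 hL0
  have h8 : 8 * 2 ^ r < L := by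
    have := Nat.two_pow_pos r
    rw [pow_add] at hpow
    omega
  have hf := hA.half_le (r := r) (by omega) (Nat.pow_log_le_self 2 (by omega : n ≠ 0)) h8
  have hr6 : (6 : ℝ) ≤ r := by exact_mod_cast (by omega : 6 ≤ r)
  rw [hr] at hle
  push_cast at hle
  rw [Real.norm_of_nonneg (by linarith), Real.norm_of_nonneg (by linarith)]
  linarith
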